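/- Fix a non-empty set $\Sigma$ of labels. A \emph{weak higher dimensional transition system} (weak HDTS) consists of a set $S$ of states, a set $L$ of actions, a labelling map $\mu:L\to\Sigma$, and for each $n\ge 1$ a set $T_n\subseteq S\times L^n\times S$ of $n$-transitions (put $T=\bigcup_{n\geq 1}T_n$) such that: (Multiset axiom) if $(\alpha,u_1,\dots,u_n,\beta)\in T$, then $(\alpha,u_{\sigma(1)},\dots,u_{\sigma(n)},\beta)\in T$ for every permutation $\sigma$ of $\{1,\dots,n\}$; (Coherence axiom) for $n\ge 3$ and $p,q\ge1$ with $p+q<n$, if $(\alpha,u_1,\dots,u_n,\beta)$, $(\alpha,u_1,\dots,u_p,\nu_1)$, $(\nu_1,u_{p+1},\dots,u_n,\beta)$, $(\alpha,u_1,\dots,u_{p+q},\nu_2)$ and $(\nu_2,u_{p+q+1},\dots,u_n,\beta)$ are transitions, then so is $(\nu_1,u_{p+1},\dots,u_{p+q},\nu_2)$. A map of weak HDTS is a map on states together with a label-preserving map on actions, which send transitions to transitions. Let $\mathbf{WHDTS}$ be the resulting category. For $n\ge 0$ and $x_1,\dots,x_n\in\Sigma$, the \emph{$n$-cube} $C_n[x_1,\dots,x_n]$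 has states $\{0,1\}^n$, actions $(x_1,1),\dots,(x_n,n)$ with $\mu(x_i,i)=x_i$, and transitions all tuples $(\epsilon,(x_{i_1},i_1),\dots,(x_{i_d},i_d),\epsilon')$ with $d\geq 1$, $i_1,\dots,i_d$ pairwise distinct, $\epsilon\le\epsilon'$ coordinatewise, and $\epsilon_i\ne\epsilon'_i$ exactly for $i\in\{i_1,\dots,i_d\}$. For $x\in\Sigma$, the \emph{double transition} $\uparrow\! x\!\uparrow$ has states $\{1,2,3,4\}$, one action $x$, labelled by $x$, and the two transitions $(1,x,2)$ and $(3,x,4)$. A \emph{subcube} of a weak HDTS $X$ is the image (the least subobject through which it factors) of a map from a cube to $X$; $X$ is a \emph{cubical transition system} if it is equal to the union (the least upper bound in the family of subobjects of $X$) of its subcubes. Let $\mathbf{CTS}$ be the full subcategory of cubical transition systems. \textbf{Theorem.} Let $X$ be a weak HDTS. The colimit $\varinjlim_f \mathrm{dom}(f)$, taken in $\mathbf{WHDTS}$ over the category of all maps $f$ of the form $C_n[x_1,\dots,x_n]\to X$ or $\uparrow\! x\!\uparrow\;\to X$ (for all $n\geq 0$ and $x_1,\dots,x_n,x\in\Sigma$),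 exists, and the canonical map $q_X:\varinjlim_f\mathrm{dom}(f)\to X$ is bijective on states and one-to-one on actions and on transitions. Moreover, $X$ is cubical if and only if $q_X$ is an isomorphism. The map $q_X$ is the counit of a coreflection: $\mathrm{dom}(q_X)$ is cubical, and every map from a cubical transition system to $X$ factors uniquely through $q_X$. Consequently, $\mathbf{CTS}$ is an isomorphism-closed coreflective subcategory of $\mathbf{WHDTS}$ (the inclusion has a right adjoint), and $\mathbf{CTS}$ is a locally finitely presentable category. The cubes $C_n[x_1,\dots,x_n]$ and the double transitions $\uparrow\! x\!\uparrow$ are cubical, and the full subcategory that they generate is dense in $\mathbf{CTS}$. -/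

import Mathlib

open CategoryTheory CategoryTheory.Limits

universe u

/-- A weak higher dimensional transition system over the set of labels `Lab`. The relation
`Tr a l b` says that `(a, u₁, …, uₙ, b)` is a transition, where `l = [u₁, …, uₙ]` and `n ≥ 1`. -/
structure WHDTS (Lab : Type u) : Type (u + 1) where
  /-- The set of states. -/
  State : Type u
  /-- The set of actions. -/
  Action : Type u
  /-- The labelling map. -/
  label : Action → Lab
  /-- The set of transitions. -/
  Tr : State → List Action → State → Prop
  ne_nil : ∀ {a : State} {l : List Action} {b : State}, Tr a l b → l ≠ []
  /-- Multiset axiom. -/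
  multiset : ∀ {a : State} {l l' : List Action} {b : State}, l.Perm l' → Tr a l b → Tr a l' b
  /-- Coherence axiom (the lists `l₁`, `l₂`, `l₃` play the roles of `u₁ … u_p`,
  `u_{p+1} … u_{p+q}` and `u_{p+q+1} … u_n`; `l₁` and `l₃` are non-empty by `ne_nil`). -/
  coherence : ∀ {a n₁ n₂ b : State} {l₁ l₂ l₃ : List Action}, l₂ ≠ [] →
    Tr a (l₁ ++ l₂ ++ l₃) b → Tr a l₁ n₁ → Tr n₁ (l₂ ++ l₃) b →
    Tr a (l₁ ++ l₂) n₂ → Tr n₂ l₃ b → Tr n₁ l₂ n₂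

namespace WHDTS

variable {Lab : Type u}

/-- A map of weak HDTS: a map on states and a label-preserving map on actions which send
transitions to transitions. -/
@[ext]
structure Hom (X Y : WHDTS Lab) where
  /-- The map on states. -/
  state : X.State → Y.State
  /-- The map on actions. -/
  action : X.Action → Y.Action
  label_action : ∀ v : X.Action, Y.label (action v) = X.label v
  map_tr : ∀ {a : X.State} {l : List X.Action} {b : X.State},
    X.Tr a l b → Y.Tr (state a) (l.map action) (state b)

instance : Category.{u} (WHDTS Lab) where
  Hom X Y := Hom X Y
  id X :=
    { state := id
      action := id
      label_action := fun _ => rfl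
      map_tr := fun h => by simpa using h }
  comp f g :=
    { state := g.state ∘ f.state
      action := g.action ∘ f.action
      label_action := fun v => (g.label_action _).trans (f.label_action v)
      map_tr := fun h => by simpa using g.map_tr (f.map_tr h) }

/-- The set of all transitions of a weak HDTS (of all dimensions `n ≥ 1`). -/
def Transition (X : WHDTS Lab) : Type u :=
  {t : X.State × List X.Action × X.State // X.Tr t.1 t.2.1 t.2.2}

/-- The map on states induced by a map of weak HDTS. -/
def mapState {X Y : WHDTS Lab} (f : X ⟶ Y) : X.State → Y.State := Hom.state f

/-- The map on actions induced by a map of weak HDTS. -/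
def mapAction {X Y : WHDTS Lab} (f : X ⟶ Y) : X.Action → Y.Action := Hom.action f

/-- The map on transitions induced by a map of weak HDTS. -/
def mapTransition {X Y : WHDTS Lab} (f : X ⟶ Y) : X.Transition → Y.Transition := fun t =>
  ⟨(mapState f t.1.1, t.1.2.1.map (mapAction f), mapState f t.1.2.2), Hom.map_tr f t.2⟩

/-- The `n`-cube `C_n[x₁, …, xₙ]`. The action `(x_i, i)` is represented by the index `i`. There
is a transition from `e` to `e'` labelled by a list of pairwise distinct indices if and only if
`e ≤ e'` and the list consists exactly of the coordinates where `e` and `e'` differ. -/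
def cube (n : ℕ) (x : Fin n → Lab) : WHDTS Lab where
  State := ULift.{u} (Fin n → Bool)
  Action := ULift.{u} (Fin n)
  label i := x i.down
  Tr e l e' := l ≠ [] ∧ l.Nodup ∧ (∀ i, e.down i ≤ e'.down i) ∧
    ∀ i, e.down i ≠ e'.down i ↔ ULift.up i ∈ l
  ne_nil h := h.1
  multiset := by
    rintro a l l' b hp ⟨h1, h2, h3, h4⟩
    refine ⟨fun h => h1 ?_, hp.nodup_iff.1 h2, h3, fun i => (h4 i).trans hp.mem_iff⟩
    subst h
    exact hp.eq_nil
  coherence := by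
    rintro a n₁ n₂ b l₁ l₂ l₃ hl ⟨-, hd, hle, h0⟩ ⟨-, -, hle1, h1⟩ ⟨-, -, hle2, h2⟩
      ⟨-, -, hle3, h3⟩ ⟨-, -, hle4, h4⟩
    have key : ∀ i, n₁.down i ≤ n₂.down i ∧ (n₁.down i ≠ n₂.down i ↔ ULift.up i ∈ l₂) := by
      intro i
      have d1 : ULift.up i ∈ l₁ → ULift.up i ∉ l₂ := fun h h' =>
        (List.nodup_append.1 (List.nodup_append.1 hd).1).2.2 _ h _ h' rfl
      have e0 := h0 i
      have e1 := h1 i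
      have e2 := h2 i
      have e3 := h3 i
      have e4 := h4 i
      have o0 := hle i
      have o1 := hle1 i
      have o2 := hle2 i
      have o3 := hle3 i
      have o4 := hle4 i
      simp only [List.mem_append] at e0 e1 e2 e3 e4
      by_cases m1 : ULift.up i ∈ l₁ <;> by_cases m2 : ULift.up i ∈ l₂ <;>
        by_cases m3 : ULift.up i ∈ l₃ <;>
        simp only [m1, m2, m3, or_true, or_false, or_self, iff_true, iff_false,
          not_not, not_true_eq_false, not_false_eq_true, imp_false] at * <;>
        revert o0 o1 o2 o3 o4 e0 e1 e2 e3 e4 <;>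
        cases a.down i <;> cases b.down i <;> cases n₁.down i <;> cases n₂.down i <;>
        simp
    exact ⟨hl, ((List.nodup_append.1 (List.nodup_append.1 hd).1).2.1), fun i => (key i).1,
      fun i => (key i).2⟩

/-- The double transition labelled by `x`: four states `1, 2, 3, 4` (here numbered from `0`), one
action labelled by `x`, and the two transitions `(1, x, 2)` and `(3, x, 4)`. -/
def double (x : Lab) : WHDTS Lab where
  State := ULift.{u} (Fin 4)
  Action := PUnit.{u + 1}
  label _ := x
  Tr a l b := l = [PUnit.unit] ∧ ((a.down = 0 ∧ b.down = 1) ∨ (a.down = 2 ∧ b.down = 3))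
  ne_nil := by
    rintro a l b ⟨rfl, -⟩
    simp
  multiset := by
    rintro a l l' b hp ⟨rfl, h⟩
    exact ⟨List.perm_singleton.1 hp.symm, h⟩
  coherence := by
    rintro a n₁ n₂ b l₁ l₂ l₃ hl ⟨h, -⟩ ⟨rfl, -⟩ - - -
    exfalso
    have := congrArg List.length h
    have h2 := List.length_pos_of_ne_nil hl
    simp at this
    lia

/-- The map `f` exhibits `P` as its image: `P` is the least subobject of `X` through which `f`
factors. -/
def IsImage {Y X : WHDTS Lab} (f : Y ⟶ X) (P : Subobject X) : Prop :=
  IsLeast {Q : Subobject X | Q.Factors f} P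

/-- The subcubes of `X`, i.e. the images of the cubes `C_n[x₁, …, xₙ] ⟶ X` of `X`. -/
def subcubes (X : WHDTS Lab) : Set (Subobject X) :=
  {P | ∃ (n : ℕ) (x : Fin n → Lab) (f : cube n x ⟶ X), IsImage f P}

/-- A weak HDTS is a cubical transition system if it is equal to the union (the least upper bound
in the family of subobjects) of its subcubes. -/
def IsCubical (Lab : Type u) : ObjectProperty (WHDTS Lab) :=
  fun X => IsLUB X.subcubes ⊤

/-- The full subcategory of cubical transition systems. -/
abbrev CTS (Lab : Type u) : Type (u + 1) := (IsCubical Lab).FullSubcategory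

/-- Indices for the cubes and the double transitions. -/
inductive Shape (Lab : Type u) : Type u
  | cube (n : ℕ) (x : Fin n → Lab) : Shape Lab
  | double (x : Lab) : Shape Lab

/-- The cube or double transition with a given index. -/
def Shape.toWHDTS : Shape Lab → WHDTS Lab
  | .cube n x => WHDTS.cube n x
  | .double x => WHDTS.double x

/-- The small category of all cubes and double transitions, and all maps of weak HDTS
between them. -/
abbrev Gen (Lab : Type u) : Type u :=
  InducedCategory (WHDTS Lab) (Shape.toWHDTS (Lab := Lab))

/-- The fully faithful functor from the category of cubes and double transitions to weak HDTS. -/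
abbrev genFunctor (Lab : Type u) : Gen Lab ⥤ WHDTS Lab :=
  inducedFunctor (Shape.toWHDTS (Lab := Lab))

/-- The diagram `f ↦ dom f` indexed by the category of all maps `f` to `X` from a cube or a double
transition (the maps from `f` to `g` being the maps `h` from `dom f` to `dom g` with
`g ∘ h = f`). -/
abbrev genDiagram (X : WHDTS Lab) : CostructuredArrow (genFunctor Lab) X ⥤ WHDTS Lab :=
  CostructuredArrow.proj (genFunctor Lab) X ⋙ genFunctor Lab

/-- The canonical cocone with point `X` over the diagram `f ↦ dom f`, whose component at `f`
is `f`. -/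
def genCocone (X : WHDTS Lab) : Cocone (genDiagram X) where
  pt := X
  ι :=
    { app := fun f => f.hom
      naturality := fun f g h => by
        exact (CostructuredArrow.w h).trans (Category.comp_id f.hom).symm }

end WHDTS

namespace WHDTS

variable {Lab : Type u}

/-! Everything rests on an explicit model of the colimit. For a weak HDTS `X`, let `cubicalPart X`
have all states of `X`, the actions of `X` occurring in some 1-transition, and the transitions
generated under the multiset and coherence axioms (`Closure`) by the images of transitions of cubes.
It embeds in `X`, bijectively on states. Call `X` cube generated (`IsCubeGenerated`) when this
construction loses nothing. Maps preserve 1-transitions and cube images, so every map from a cube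
generated object lifts to the cubical part (`exists_lift_cubicalPart`); since `cubicalPart X` is
itself cube generated, it is the coreflection. By `isCubical_iff`, cube generated is the same as
cubical.

To see that the cubical part is the colimit, take a compatible family of maps on cubes and double
transitions over `X`. Points (0-cubes) determine the map on states, edges (1-cubes) the map on
actions, and n-cubes show that generating transitions are respected. The only danger is that two
edges of `X` with the same action receive different values; both edges factor through one double
transition, which rules this out (`mapAction_ofTr_eq`, `exists_desc`). For cubical `X` this says
that the generators are dense.

For local presentability, colimits of weak HDTS are computed on states and actions, with generated
transitions. In a filtered colimit generation adds nothing: every transition already comes from a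
stage (`stageTr_of_tr`). Hence finite objects, in particular the generators, are finitely
presentable. Being coreflective, `CTS` is cocomplete and its inclusion preserves colimits, so the
generators form a strong generator of finitely presentable objects. -/

/-- Build a map of weak HDTS from its components. -/
def mkHom {X Y : WHDTS Lab} (s : X.State → Y.State) (a : X.Action → Y.Action)
    (hl : ∀ v, Y.label (a v) = X.label v)
    (ht : ∀ {p l q}, X.Tr p l q → Y.Tr (s p) (l.map a) (s q)) : X ⟶ Y :=
  Hom.mk s a hl ht

/-! ### Maps on states, actions and transitions -/

section basic

variable {X Y Z : WHDTS Lab}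

@[simp]
lemma mapAction_id : mapAction (𝟙 X) = id := rfl

@[simp]
lemma mapState_comp (f : X ⟶ Y) (g : Y ⟶ Z) :
    mapState (f ≫ g) = mapState g ∘ mapState f := rfl

@[simp]
lemma mapAction_comp (f : X ⟶ Y) (g : Y ⟶ Z) :
    mapAction (f ≫ g) = mapAction g ∘ mapAction f := rfl

lemma hom_ext {f g : X ⟶ Y} (hs : mapState f = mapState g) (ha : mapAction f = mapAction g) :
    f = g :=
  Hom.ext hs ha

lemma label_mapAction (f : X ⟶ Y) (v : X.Action) : Y.label (mapAction f v) = X.label v :=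
  Hom.label_action f v

lemma tr_map (f : X ⟶ Y) {a : X.State} {l : List X.Action} {b : X.State} (h : X.Tr a l b) :
    Y.Tr (mapState f a) (l.map (mapAction f)) (mapState f b) :=
  Hom.map_tr f h

lemma mapTransition_injective (f : X ⟶ Y) (hs : Function.Injective (mapState f))
    (ha : Function.Injective (mapAction f)) : Function.Injective (mapTransition f) := by
  rintro ⟨⟨a, l, b⟩, h⟩ ⟨⟨a', l', b'⟩, h'⟩ e
  have e := congrArg Subtype.val e
  simp only [mapTransition, Prod.mk.injEq] at e
  obtain ⟨e1, e2, e3⟩ := e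
  obtain rfl := hs e1
  obtain rfl := List.map_injective_iff.2 ha e2
  obtain rfl := hs e3
  rfl

lemma mono_of_injective (f : X ⟶ Y) (hs : Function.Injective (mapState f))
    (ha : Function.Injective (mapAction f)) : Mono f where
  right_cancellation g h e := by
    refine hom_ext (funext fun x => hs ?_) (funext fun x => ha ?_)
    · exact congrFun (congrArg mapState e) x
    · exact congrFun (congrArg mapAction e) x

end basic

/-! ### Generated transitions -/

/-- The closure of a relation under the multiset and coherence axioms. -/
inductive Closure {S A : Type u} (R : S → List A → S → Prop) : S → List A → S → Prop
  | base {a l b} : R a l b → Closure R a l b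
  | multiset {a l l' b} : l.Perm l' → Closure R a l b → Closure R a l' b
  | coherence {a n₁ n₂ b l₁ l₂ l₃} : l₂ ≠ [] → Closure R a (l₁ ++ l₂ ++ l₃) b →
      Closure R a l₁ n₁ → Closure R n₁ (l₂ ++ l₃) b → Closure R a (l₁ ++ l₂) n₂ →
      Closure R n₂ l₃ b → Closure R n₁ l₂ n₂

namespace Closure

variable {S A S' A' : Type u} {R : S → List A → S → Prop} {R' : S' → List A' → S' → Prop}

lemma ne_nil (hR : ∀ {a l b}, R a l b → l ≠ []) {a l b} (h : Closure R a l b) : l ≠ [] := by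
  induction h with
  | base h => exact hR h
  | multiset hp _ ih =>
    rintro rfl
    exact ih hp.eq_nil
  | coherence h => exact h

lemma toTr {X : WHDTS Lab} {s : S → X.State} {t : A → X.Action}
    (hR : ∀ {a l b}, R a l b → X.Tr (s a) (l.map t) (s b)) {a l b} (h : Closure R a l b) :
    X.Tr (s a) (l.map t) (s b) := by
  induction h with
  | base h => exact hR h
  | multiset hp _ ih => exact X.multiset (hp.map t) ih
  | coherence h _ _ _ _ _ h1 h2 h3 h4 h5 =>
    simp only [List.map_append] at h1 h3 h4
    exact X.coherence (by simpa using h) h1 h2 h3 h4 h5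

lemma map {s : S → S'} {t : A → A'}
    (hR : ∀ {a l b}, R a l b → Closure R' (s a) (l.map t) (s b)) {a l b} (h : Closure R a l b) :
    Closure R' (s a) (l.map t) (s b) := by
  induction h with
  | base h => exact hR h
  | multiset hp _ ih => exact .multiset (hp.map t) ih
  | coherence h _ _ _ _ _ h1 h2 h3 h4 h5 =>
    simp only [List.map_append] at h1 h3 h4
    exact .coherence (by simpa using h) h1 h2 h3 h4 h5

end Closure

/-- The weak HDTS whose transitions are generated by a relation. -/
@[simps]
def generate {S A : Type u} (lab : A → Lab) (R : S → List A → S → Prop)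
    (hR : ∀ {a l b}, R a l b → l ≠ []) : WHDTS Lab where
  State := S
  Action := A
  label := lab
  Tr := Closure R
  ne_nil := Closure.ne_nil hR
  multiset := .multiset
  coherence := .coherence

/-- A map factors through a map that is injective on states and actions as soon as it does
so on states, actions and generating transitions. -/
lemma exists_lift {Q X Y : WHDTS Lab} (i : Q ⟶ X) (hs : Function.Injective (mapState i))
    (ha : Function.Injective (mapAction i)) (g : Y ⟶ X)
    (hgs : ∀ a, ∃ a', mapState i a' = mapState g a)
    (hga : ∀ v, ∃ v', mapAction i v' = mapAction g v)
    (R : Y.State → List Y.Action → Y.State → Prop)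
    (hY : ∀ a l b, Y.Tr a l b → Closure R a l b)
    (hR : ∀ a l b, R a l b → ∃ a' l' b', Q.Tr a' l' b' ∧ mapState i a' = mapState g a ∧
      l'.map (mapAction i) = l.map (mapAction g) ∧ mapState i b' = mapState g b) :
    ∃ h : Y ⟶ Q, h ≫ i = g := by
  choose s hs' using hgs
  choose t ht' using hga
  refine ⟨mkHom s t (fun v => ?_) (fun {a l b} h => ?_),
    hom_ext (funext hs') (funext ht')⟩
  · rw [← label_mapAction i, ht', label_mapAction]
  -- `Q` satisfies both axioms, so only generating transitions matter; injectivity of `i` identifies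
  -- their lifts with the chosen ones.
  · refine Closure.toTr (fun {a l b} h => ?_) (hY _ _ _ h)
    obtain ⟨a', l', b', h', e1, e2, e3⟩ := hR a l b h
    rw [← hs'] at e1 e3
    obtain rfl := hs e1
    obtain rfl := hs e3
    have : l' = l.map t := by
      apply List.map_injective_iff.2 ha
      rw [e2, List.map_map]
      exact List.map_congr_left fun v _ => (ht' v).symm
    rwa [← this]

/-! ### Points, edges and pairs of edges; monomorphisms -/

/-- The point of a weak HDTS given by a state. -/
def ofState (X : WHDTS Lab) (n : Fin 0 → Lab) (a : X.State) : cube 0 n ⟶ X :=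
  mkHom (fun _ => a) (fun v => v.down.elim0) (fun v => v.down.elim0) (fun h =>
    (h.1 (List.eq_nil_iff_forall_not_mem.2 fun v => v.down.elim0)).elim)

lemma eq_singleton_of_nodup {A : Type u} [Subsingleton A] {l : List A} (hl : l ≠ [])
    (hn : l.Nodup) (v : A) : l = [v] := by
  match l, hl, hn with
  | [w], _, _ => rw [Subsingleton.elim w v]
  | w :: w' :: l, _, hn => simp [Subsingleton.elim w w'] at hn

/-- The `1`-cube of a weak HDTS given by a `1`-transition. -/
def ofTr (X : WHDTS Lab) {a : X.State} {v : X.Action} {b : X.State} (h : X.Tr a [v] b)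
    {x : Lab} (hx : X.label v = x) : cube 1 (fun _ => x) ⟶ X :=
  mkHom (fun e => if e.down 0 then b else a) (fun _ => v) (fun _ => hx) (fun {p l q} h' => by
    obtain ⟨h1, h2, h3, h4⟩ := h'
    obtain rfl := eq_singleton_of_nodup (A := ULift (Fin 1)) h1 h2 ⟨0⟩
    have h3 := h3 0
    have h4 := h4 0
    -- The single coordinate must change, and only upwards, so `false` to `true` is the only
    -- possible case.
    cases hp : p.down 0 <;> cases hq : q.down 0
    · simp_all
    · exact h
    · rw [hp, hq] at h3
      exact absurd h3 (by decide)
    · simp_all)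

lemma ofTr_comp {X Y : WHDTS Lab} {a : X.State} {v : X.Action} {b : X.State} (h : X.Tr a [v] b)
    {x : Lab} (hx : X.label v = x) (f : X ⟶ Y) :
    ofTr X h hx ≫ f = ofTr Y (tr_map f h) ((label_mapAction f v).trans hx) :=
  hom_ext (funext fun e => apply_ite (mapState f) (e.down 0 = true) b a) rfl

/-- The double transition of a weak HDTS given by two `1`-transitions with the same action. -/
def ofTrTr (X : WHDTS Lab) {a b c d : X.State} {v : X.Action} (h : X.Tr a [v] b)
    (h' : X.Tr c [v] d) {x : Lab} (hx : X.label v = x) : double x ⟶ X :=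
  mkHom (fun e => ![a, b, c, d] e.down) (fun _ => v) (fun _ => hx) (by
    rintro ⟨p⟩ l ⟨q⟩ ⟨rfl, hh⟩
    obtain ⟨rfl, rfl⟩ | ⟨rfl, rfl⟩ := hh
    exacts [h, h'])

lemma exists_tr_cube (n : ℕ) (x : Fin n → Lab) (v : (cube n x).Action) :
    ∃ a b, (cube n x).Tr a [v] b := by
  change ULift (Fin n) at v
  -- The edge from the origin to the unit vector in direction `v`.
  exact ⟨⟨fun _ => false⟩, ⟨fun i => decide (ULift.up i = v)⟩, List.cons_ne_nil v [],
    List.nodup_singleton v, fun i => Bool.false_le _,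
    fun i => by
      refine Iff.trans ?_ (List.mem_singleton (a := ULift.up i) (b := v)).symm
      simp⟩

/-- The weak HDTS with no state and a single action. -/
def freeAction (x : Lab) : WHDTS Lab where
  State := PEmpty
  Action := PUnit
  label _ := x
  Tr _ _ _ := False
  ne_nil h := h.elim
  multiset _ h := h.elim
  coherence _ h := h.elim

/-- States are detected by the 0-cube and actions by `freeAction`. A 1-cube would not suffice for
actions, since an action need not occur in any transition. -/
lemma injective_of_mono {X Y : WHDTS Lab} (f : X ⟶ Y) [Mono f] :
    Function.Injective (mapState f) ∧ Function.Injective (mapAction f) := by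
  constructor
  · intro a b h
    have : ofState X Fin.elim0 a = ofState X Fin.elim0 b := by
      rw [← cancel_mono f]
      refine hom_ext (funext fun _ => h) (funext fun v => v.down.elim0)
    exact congrFun (congrArg mapState this) ⟨Fin.elim0⟩
  · intro v w h
    have hl : X.label v = X.label w := by rw [← label_mapAction f, h, label_mapAction]
    let k (v' : X.Action) (hv : X.label v' = X.label v) : freeAction (X.label v) ⟶ X :=
      mkHom PEmpty.elim (fun _ => v') (fun _ => hv) (fun h => h.elim)
    have : k v rfl = k w hl.symm := by
      rw [← cancel_mono f]
      exact hom_ext (funext fun v => v.elim) (funext fun _ => h)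
    exact congrFun (congrArg mapAction this) ⟨⟩

/-! ### Cube generated systems and the cubical part -/

/-- The relation generated by the images of the transitions under a map. -/
def ImageTr {X Y : WHDTS Lab} (f : Y ⟶ X) (a : X.State) (l : List X.Action) (b : X.State) : Prop :=
  ∃ e m e', Y.Tr e m e' ∧ mapState f e = a ∧ m.map (mapAction f) = l ∧ mapState f e' = b

/-- The transitions of a weak HDTS that come from a cube. -/
def CubeTr (X : WHDTS Lab) (a : X.State) (l : List X.Action) (b : X.State) : Prop :=
  ∃ (n : ℕ) (x : Fin n → Lab) (f : cube n x ⟶ X), ImageTr f a l b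

lemma ImageTr.tr {X Y : WHDTS Lab} {f : Y ⟶ X} {a l b} (h : ImageTr f a l b) : X.Tr a l b := by
  obtain ⟨e, m, e', h, rfl, rfl, rfl⟩ := h
  exact tr_map f h

lemma CubeTr.tr {X : WHDTS Lab} {a l b} (h : CubeTr X a l b) : X.Tr a l b := by
  obtain ⟨n, x, f, h⟩ := h
  exact h.tr

lemma CubeTr.map {X Y : WHDTS Lab} (g : X ⟶ Y) {a l b} (h : CubeTr X a l b) :
    CubeTr Y (mapState g a) (l.map (mapAction g)) (mapState g b) := by
  obtain ⟨n, x, f, e, m, e', h, rfl, rfl, rfl⟩ := h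
  exact ⟨n, x, f ≫ g, e, m, e', h, rfl, by simp, rfl⟩

lemma cubeTr_singleton {X : WHDTS Lab} {a v b} (h : X.Tr a [v] b) : CubeTr X a [v] b := by
  refine ⟨1, _, ofTr X h rfl, ⟨fun _ => false⟩, [⟨0⟩], ⟨fun _ => true⟩,
    ⟨List.cons_ne_nil (ULift.up (0 : Fin 1)) [], List.nodup_singleton (ULift.up (0 : Fin 1)),
      fun i => Bool.false_le _, fun i => ?_⟩, rfl, rfl, rfl⟩
  refine Iff.trans ?_ (List.mem_singleton (a := ULift.up i) (b := ULift.up (0 : Fin 1))).symm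
  simp [Subsingleton.elim i 0]

/-- Every action is used by a `1`-transition and the transitions are generated by the
transitions coming from cubes. -/
structure IsCubeGenerated (X : WHDTS Lab) : Prop where
  exists_tr (v : X.Action) : ∃ a b, X.Tr a [v] b
  closure {a l b} : X.Tr a l b → Closure (CubeTr X) a l b

lemma isCubeGenerated_cube (n : ℕ) (x : Fin n → Lab) : IsCubeGenerated (cube n x) where
  exists_tr := exists_tr_cube n x
  closure {_ l _} h := .base ⟨n, x, 𝟙 _, _, _, _, h, rfl, by simp, rfl⟩

lemma isCubeGenerated_double (x : Lab) : IsCubeGenerated (double x) where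
  exists_tr _ := ⟨⟨0⟩, ⟨1⟩, rfl, .inl ⟨rfl, rfl⟩⟩
  closure {a l b} h := by
    obtain rfl := h.1
    exact .base (cubeTr_singleton h)

lemma isCubeGenerated_genFunctor (s : Gen Lab) : IsCubeGenerated ((genFunctor Lab).obj s) := by
  match s with
  | .cube n x => exact isCubeGenerated_cube n x
  | .double x => exact isCubeGenerated_double x

lemma IsCubeGenerated.of_iso {X Y : WHDTS Lab} (e : X ≅ Y) (hX : IsCubeGenerated X) :
    IsCubeGenerated Y where
  exists_tr v := by
    obtain ⟨a, b, h⟩ := hX.exists_tr (mapAction e.inv v)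
    refine ⟨mapState e.hom a, mapState e.hom b, ?_⟩
    have := tr_map e.hom h
    rwa [List.map_singleton, ← Function.comp_apply (f := mapAction e.hom), ← mapAction_comp,
      e.inv_hom_id] at this
  closure {a l b} h := by
    have := (hX.closure (tr_map e.inv h)).map (R' := CubeTr Y) (s := mapState e.hom)
      (t := mapAction e.hom) (fun h => .base (h.map e.hom))
    rwa [List.map_map, ← mapAction_comp, ← Function.comp_apply (f := mapState e.hom),
      ← Function.comp_apply (f := mapState e.hom), ← mapState_comp, e.inv_hom_id, mapAction_id,
      List.map_id] at this

/-- The largest cubical transition system mapping to a weak HDTS `X`. -/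
def cubicalPart (X : WHDTS Lab) : WHDTS Lab :=
  generate (S := X.State) (A := {v : X.Action // ∃ a b, X.Tr a [v] b}) (fun v => X.label v.1)
    (fun a l b => CubeTr X a (l.map Subtype.val) b)
    (fun h hl => X.ne_nil h.tr (by rw [hl, List.map_nil]))

/-- The inclusion of the cubical part. -/
def cubicalPartι (X : WHDTS Lab) : cubicalPart X ⟶ X :=
  mkHom id Subtype.val (fun _ => rfl) (fun h => Closure.toTr (fun h => h.tr) h)

lemma mapState_cubicalPartι_bijective (X : WHDTS Lab) :
    Function.Bijective (mapState (cubicalPartι X)) :=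
  Function.bijective_id

lemma mapAction_cubicalPartι_injective (X : WHDTS Lab) :
    Function.Injective (mapAction (cubicalPartι X)) :=
  Subtype.val_injective

instance (X : WHDTS Lab) : Mono (cubicalPartι X) :=
  mono_of_injective _ (mapState_cubicalPartι_bijective X).1 (mapAction_cubicalPartι_injective X)

/-- Actions of `Y` lie on 1-transitions, which `g` preserves, and composing a cube of `Y` with `g`
gives a cube of `X`; so `exists_lift` applies. -/
lemma exists_lift_cubicalPart {X Y : WHDTS Lab} (hY : IsCubeGenerated Y) (g : Y ⟶ X) :
    ∃ h : Y ⟶ cubicalPart X, h ≫ cubicalPartι X = g := by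
  have hg (v : Y.Action) : ∃ a b, X.Tr a [mapAction g v] b := by
    obtain ⟨a, b, h⟩ := hY.exists_tr v
    exact ⟨_, _, tr_map g h⟩
  have e (l : List Y.Action) : (l.map fun v => (⟨mapAction g v, hg v⟩ :
      {v : X.Action // ∃ a b, X.Tr a [v] b})).map Subtype.val = l.map (mapAction g) := by
    rw [List.map_map]
    rfl
  refine exists_lift _ (mapState_cubicalPartι_bijective X).1 (mapAction_cubicalPartι_injective X)
    g (fun a => ⟨(show X.State from mapState g a), rfl⟩)
    (fun v => ⟨⟨mapAction g v, hg v⟩, rfl⟩) (CubeTr Y)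
    (fun a l b h => hY.closure h) (fun a l b h => ?_)
  refine ⟨(show X.State from mapState g a), l.map fun v => ⟨mapAction g v, hg v⟩,
    (show X.State from mapState g b), .base ?_, rfl, e l, rfl⟩
  exact (congrArg (CubeTr X (mapState g a) · (mapState g b)) (e l)).mpr (h.map g)

/-- The construction is idempotent: cubes are cube generated, so each cube of `X` used as a
generator lifts to a cube of the cubical part. -/
lemma isCubeGenerated_cubicalPart (X : WHDTS Lab) : IsCubeGenerated (cubicalPart X) where
  exists_tr v := by
    obtain ⟨a, b, h⟩ := v.2
    exact ⟨a, b, .base (cubeTr_singleton h)⟩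
  closure {a l b} h := by
    have := Closure.map (R' := CubeTr (cubicalPart X)) (s := id) (t := id) (fun {a l b} h => ?_) h
    · simpa only [List.map_id, id] using this
    · obtain ⟨n, x, f, e, m, e', h, h1, h2, h3⟩ := h
      obtain ⟨f', rfl⟩ := exists_lift_cubicalPart (isCubeGenerated_cube n x) f
      refine .base ⟨n, x, f', e, m, e', h, h1, ?_, h3⟩
      rw [List.map_id]
      apply List.map_injective_iff.2 (mapAction_cubicalPartι_injective X)
      rw [List.map_map]
      exact h2

lemma IsCubeGenerated.isIso {X : WHDTS Lab} (hX : IsCubeGenerated X) :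
    IsIso (cubicalPartι X) := by
  obtain ⟨h, hh⟩ := exists_lift_cubicalPart hX (𝟙 X)
  -- A monomorphism with a section is invertible.
  exact ⟨h, by rw [← cancel_mono (cubicalPartι X)]; simp [hh], hh⟩

/-! ### Images, and cubical means cube generated -/

/-- The image of a map. -/
def image {Y X : WHDTS Lab} (f : Y ⟶ X) : WHDTS Lab :=
  generate (S := Set.range (mapState f)) (A := Set.range (mapAction f)) (fun v => X.label v.1)
    (fun a l b => ImageTr f a.1 (l.map Subtype.val) b.1)
    (fun h hl => X.ne_nil h.tr (by rw [hl, List.map_nil]))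

/-- The inclusion of the image. -/
def imageι {Y X : WHDTS Lab} (f : Y ⟶ X) : image f ⟶ X :=
  mkHom Subtype.val Subtype.val (fun _ => rfl) (fun h => Closure.toTr (fun h => h.tr) h)

instance {Y X : WHDTS Lab} (f : Y ⟶ X) : Mono (imageι f) :=
  mono_of_injective _ Subtype.val_injective Subtype.val_injective

lemma isImage_imageι {Y X : WHDTS Lab} (f : Y ⟶ X) : IsImage f (Subobject.mk (imageι f)) := by
  constructor
  · refine (Subobject.mk_factors_iff _ _).2 ?_
    let g : Y ⟶ image f := mkHom (Set.rangeFactorization (mapState f))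
      (Set.rangeFactorization (mapAction f)) (fun v => label_mapAction f v)
      (fun {a l b} h => .base ⟨a, l, b, h, rfl, (List.map_map (g := Subtype.val)
        (f := Set.rangeFactorization (mapAction f))).symm, rfl⟩)
    exact ⟨g, rfl⟩
  · intro Q hQ
    obtain ⟨g, rfl⟩ : ∃ g, g ≫ Q.arrow = f := ⟨Q.factorThru f hQ, Q.factorThru_arrow f hQ⟩
    obtain ⟨hs, ha⟩ := injective_of_mono Q.arrow
    obtain ⟨h, hh⟩ := exists_lift Q.arrow hs ha (imageι (g ≫ Q.arrow))
      (by rintro ⟨_, a, rfl⟩; exact ⟨mapState g a, rfl⟩)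
      (by rintro ⟨_, a, rfl⟩; exact ⟨mapAction g a, rfl⟩) _ (fun a l b h => h)
      (by
        rintro a l b ⟨e, m, e', h, h1, h2, h3⟩
        exact ⟨_, _, _, tr_map g h, h1, List.map_map.trans h2, h3⟩)
    exact Subobject.mk_le_of_comm h hh

/-- If `X` is the union of its subcubes, then `cubicalPart X`, which contains them all, is the top
subobject. Conversely, a subobject through which all cubes factor contains every state (0-cubes),
every action (1-cubes), and every generating transition, hence everything. -/
lemma isCubical_iff (X : WHDTS Lab) : IsCubical Lab X ↔ IsCubeGenerated X := by
  constructor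
  · intro hX
    have : IsIso (cubicalPartι X) := by
      rw [Subobject.isIso_iff_mk_eq_top, ← top_le_iff]
      refine hX.2 ?_
      rintro P ⟨n, x, f, hP⟩
      refine hP.2 ((Subobject.mk_factors_iff _ _).2 ?_)
      exact exists_lift_cubicalPart (isCubeGenerated_cube n x) f
    exact (isCubeGenerated_cubicalPart X).of_iso (asIso (cubicalPartι X))
  · intro hX
    refine ⟨fun _ _ => le_top, fun Q hQ => ?_⟩
    have hf {n : ℕ} {x : Fin n → Lab} (f : cube n x ⟶ X) : ∃ g, g ≫ Q.arrow = f := by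
      have h := isImage_imageι f
      have hQ := Subobject.factors_of_le f (hQ ⟨n, x, f, h⟩) h.1
      exact ⟨Q.factorThru f hQ, Q.factorThru_arrow f hQ⟩
    obtain ⟨hs, ha⟩ := injective_of_mono Q.arrow
    obtain ⟨h, hh⟩ := exists_lift Q.arrow hs ha (𝟙 X)
      (fun a => by
        obtain ⟨g, hg⟩ := hf (ofState X Fin.elim0 a)
        exact ⟨mapState g ⟨Fin.elim0⟩, congrFun (congrArg mapState hg) _⟩)
      (fun v => by
        obtain ⟨a, b, h⟩ := hX.exists_tr v
        obtain ⟨g, hg⟩ := hf (ofTr X h rfl)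
        exact ⟨mapAction g ⟨0⟩, congrFun (congrArg mapAction hg) _⟩) (CubeTr X)
      (fun a l b h => hX.closure h)
      (by
        rintro a l b ⟨n, x, f, e, m, e', h, rfl, rfl, rfl⟩
        obtain ⟨g, rfl⟩ := hf f
        exact ⟨_, _, _, tr_map g h, rfl, by simp, rfl⟩)
    have : Subobject.mk (𝟙 X) ≤ Q := Subobject.mk_le_of_comm h hh
    rwa [← Subobject.top_eq_id] at this

/-! ### The cubical part as a colimit of cubes and double transitions -/

lemma ofState_comp {X Y : WHDTS Lab} (n : Fin 0 → Lab) (a : X.State) (f : X ⟶ Y) :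
    ofState X n a ≫ f = ofState Y n (mapState f a) :=
  hom_ext rfl (funext fun v => v.down.elim0)

/-- Maps out of a cube generated weak HDTS are determined by their restrictions to cubes and
double transitions. -/
lemma IsCubeGenerated.hom_ext {X Z : WHDTS Lab} (hX : IsCubeGenerated X) {d d' : X ⟶ Z}
    (h : ∀ (s : Shape Lab) (f : s.toWHDTS ⟶ X), f ≫ d = f ≫ d') : d = d' := by
  refine WHDTS.hom_ext (funext fun a => ?_) (funext fun v => ?_)
  · have := h (.cube 0 Fin.elim0) (ofState X _ a)
    exact congrFun (congrArg mapState this) ⟨Fin.elim0⟩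
  · obtain ⟨a, b, hv⟩ := hX.exists_tr v
    have := h (.cube 1 fun _ => X.label v) (ofTr X hv rfl)
    exact congrFun (congrArg mapAction this) ⟨0⟩

section desc

variable {X Z : WHDTS Lab} (φ : ∀ s : Shape Lab, (s.toWHDTS ⟶ X) → (s.toWHDTS ⟶ Z))
  (hφ : ∀ {s t : Shape Lab} (h : s.toWHDTS ⟶ t.toWHDTS) (f : t.toWHDTS ⟶ X),
    φ s (h ≫ f) = h ≫ φ t f)

include hφ

/-- A state of a generator is a 0-cube in it, so naturality of `φ` along this inclusion reduces its
value to the one on a point of `X`. -/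
lemma exists_mapState_eq :
    ∃ st : X.State → Z.State, ∀ s f e, mapState (φ s f) e = st (mapState f e) := by
  refine ⟨fun a => mapState (φ (.cube 0 Fin.elim0) (ofState X _ a)) ⟨Fin.elim0⟩, fun s f e => ?_⟩
  have h := hφ (s := .cube 0 Fin.elim0) (ofState s.toWHDTS _ e) f
  have h' : ofState s.toWHDTS Fin.elim0 e ≫ f = ofState X _ (mapState f e) := ofState_comp _ _ _
  exact (congrFun (congrArg mapState ((congrArg (φ (.cube 0 Fin.elim0)) h').symm.trans h))
    ⟨Fin.elim0⟩).symm

/-- This is where double transitions are needed: both edges factor through the double transition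
they form, whose single action has a single value under `φ`. -/
lemma mapAction_ofTr_eq {a b c d : X.State} {v : X.Action} (h : X.Tr a [v] b) (h' : X.Tr c [v] d)
    {x : Lab} (hx : X.label v = x) :
    mapAction (φ (.cube 1 fun _ => x) (ofTr X h hx)) ⟨0⟩ =
      mapAction (φ (.cube 1 fun _ => x) (ofTr X h' hx)) ⟨0⟩ := by
  have k1 : (double x).Tr ⟨0⟩ [PUnit.unit] ⟨1⟩ := ⟨rfl, .inl ⟨rfl, rfl⟩⟩
  have k2 : (double x).Tr ⟨2⟩ [PUnit.unit] ⟨3⟩ := ⟨rfl, .inr ⟨rfl, rfl⟩⟩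
  have e1 : ofTr X h hx = ofTr (double x) k1 rfl ≫ ofTrTr X h h' hx :=
    (ofTr_comp k1 rfl (ofTrTr X h h' hx)).symm
  have e2 : ofTr X h' hx = ofTr (double x) k2 rfl ≫ ofTrTr X h h' hx :=
    (ofTr_comp k2 rfl (ofTrTr X h h' hx)).symm
  rw [e1, e2]
  have e3 := hφ (s := .cube 1 fun _ => x) (t := .double x) (ofTr (double x) k1 rfl)
    (ofTrTr X h h' hx)
  have e4 := hφ (s := .cube 1 fun _ => x) (t := .double x) (ofTr (double x) k2 rfl)
    (ofTrTr X h h' hx)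
  exact (congrFun (congrArg mapAction e3) ⟨0⟩).trans
    (congrFun (congrArg mapAction e4) ⟨0⟩).symm

lemma exists_mapAction_eq :
    ∃ ac : {v : X.Action // ∃ a b, X.Tr a [v] b} → Z.Action,
      ∀ s f e he, mapAction (φ s f) e = ac ⟨mapAction f e, he⟩ := by
  -- Quantifying over the label `x` avoids transport: labels of an action and of its image agree
  -- only propositionally.
  have key (v : {v : X.Action // ∃ a b, X.Tr a [v] b}) : ∃ w : Z.Action,
      ∀ a b (h : X.Tr a [v.1] b), ∀ x (hx : X.label v.1 = x),
        mapAction (φ (.cube 1 fun _ => x) (ofTr X h hx)) ⟨0⟩ = w := by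
    obtain ⟨v, a, b, h⟩ := v
    refine ⟨mapAction (φ (.cube 1 fun _ => X.label v) (ofTr X h rfl)) ⟨0⟩, ?_⟩
    rintro c d h' _ rfl
    exact mapAction_ofTr_eq φ hφ h' h rfl
  choose ac hac using key
  refine ⟨ac, fun s f e he => ?_⟩
  -- Every action of a generator lies on an edge, so the claim reduces to 1-cubes by naturality.
  obtain ⟨p, q, h⟩ := (isCubeGenerated_genFunctor s).exists_tr e
  rw [← hac ⟨mapAction f e, he⟩ _ _ (tr_map f h) _ (label_mapAction f e)]
  have e3 := hφ (s := .cube 1 fun _ => s.toWHDTS.label e) (t := s) (ofTr s.toWHDTS h rfl) f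
  have e4 := congrArg (φ (.cube 1 fun _ => s.toWHDTS.label e)) (ofTr_comp h rfl f)
  exact (congrFun (congrArg mapAction (e4.symm.trans e3)) ⟨0⟩).symm

lemma exists_desc : ∃ d : cubicalPart X ⟶ Z, ∀ s (f : s.toWHDTS ⟶ cubicalPart X),
    f ≫ d = φ s (f ≫ cubicalPartι X) := by
  obtain ⟨st, hst⟩ := exists_mapState_eq φ hφ
  obtain ⟨ac, hac⟩ := exists_mapAction_eq φ hφ
  refine ⟨mkHom st ac (fun v => ?_) (fun h => Closure.toTr ?_ h), fun s f => ?_⟩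
  · obtain ⟨v, a, b, h⟩ := v
    have := hac (.cube 1 fun _ => X.label v) (ofTr X h rfl) ⟨0⟩ ⟨a, b, h⟩
    exact (congrArg Z.label this).symm.trans (label_mapAction _ _)
  -- A generating transition comes from a cube `f`, and `φ` of that cube carries it to a transition
  -- of `Z`.
  · rintro a l b ⟨n, x, f, e, m, e', h, rfl, hl, rfl⟩
    have := tr_map (φ (.cube n x) f) h
    have hf (v : (cube n x).Action) : ∃ a b, X.Tr a [mapAction f v] b := by
      obtain ⟨a, b, h⟩ := exists_tr_cube n x v
      exact ⟨_, _, tr_map f h⟩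
    change List {v : X.Action // ∃ a b, X.Tr a [v] b} at l
    have hl' : l = m.map fun v => ⟨mapAction f v, hf v⟩ := by
      apply List.map_injective_iff.2 Subtype.val_injective
      rw [← hl, List.map_map]
      rfl
    have hl'' : l.map ac = m.map (mapAction (φ (.cube n x) f)) := by
      rw [hl', List.map_map]
      exact List.map_congr_left fun v _ => (hac (.cube n x) f v (hf v)).symm
    have h1 : mapState (φ (.cube n x) f) e = st (mapState f e) := hst (.cube n x) f e
    have h2 : mapState (φ (.cube n x) f) e' = st (mapState f e') := hst (.cube n x) f e'
    rw [← hl'', h1, h2] at this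
    exact this
  · refine WHDTS.hom_ext (funext fun e => ?_) (funext fun v => ?_)
    · exact (hst s (f ≫ cubicalPartι X) e).symm
    · exact (hac s (f ≫ cubicalPartι X) v _).symm

end desc

/-- The lift to the cubical part of a map out of a cubical transition system. -/
noncomputable def liftCubicalPart {X Y : WHDTS Lab} (hY : IsCubeGenerated Y) (g : Y ⟶ X) :
    Y ⟶ cubicalPart X :=
  (exists_lift_cubicalPart hY g).choose

@[simp]
lemma liftCubicalPart_ι {X Y : WHDTS Lab} (hY : IsCubeGenerated Y) (g : Y ⟶ X) :
    liftCubicalPart hY g ≫ cubicalPartι X = g :=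
  (exists_lift_cubicalPart hY g).choose_spec

/-- The cocone exhibiting the cubical part as a colimit of cubes and double transitions. -/
noncomputable def cubicalPartCocone (X : WHDTS Lab) : Cocone (genDiagram X) where
  pt := cubicalPart X
  ι :=
    { app f := liftCubicalPart (isCubeGenerated_genFunctor f.left) f.hom
      naturality f g h := by
        rw [← cancel_mono (cubicalPartι X), Category.assoc]
        exact (congrArg ((genDiagram X).map h ≫ ·)
          (liftCubicalPart_ι (isCubeGenerated_genFunctor g.left) g.hom)).trans
          ((CostructuredArrow.w h).trans
          ((liftCubicalPart_ι (isCubeGenerated_genFunctor f.left) f.hom).symm.trans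
            (congrArg (· ≫ cubicalPartι X) (Category.comp_id _).symm))) }

/-- The cubical part is a colimit of cubes and double transitions. -/
noncomputable def isColimitCubicalPartCocone (X : WHDTS Lab) :
    IsColimit (cubicalPartCocone X) := by
  have key (c : Cocone (genDiagram X)) : ∃ d : cubicalPart X ⟶ c.pt,
      ∀ (s : Gen Lab) (f : (genFunctor Lab).obj s ⟶ cubicalPart X),
        f ≫ d = c.ι.app (CostructuredArrow.mk (S := genFunctor Lab) (Y := s)
          (f ≫ cubicalPartι X)) :=
    exists_desc (fun (s : Gen Lab) f => c.ι.app (CostructuredArrow.mk (S := genFunctor Lab) (Y := s) f))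
      (fun {s t : Gen Lab} h f => (c.w (CostructuredArrow.homMk (InducedCategory.homMk h) rfl :
        CostructuredArrow.mk (S := genFunctor Lab) (Y := s) (h ≫ f) ⟶
          CostructuredArrow.mk (S := genFunctor Lab) (Y := t) f)).symm)
  choose d hd using key
  refine
    { desc := d
      fac := fun c f => ?_
      uniq := fun c m hm => (isCubeGenerated_cubicalPart X).hom_ext fun s f => ?_ }
  · refine (hd c _ (liftCubicalPart (isCubeGenerated_genFunctor f.left) f.hom)).trans ?_
    rw [liftCubicalPart_ι]
    rfl
  · rw [hd c s f, ← hm]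
    refine congrArg (· ≫ m) ?_
    exact (cancel_mono (cubicalPartι X)).1
      (liftCubicalPart_ι (isCubeGenerated_genFunctor s) (f ≫ cubicalPartι X)).symm

lemma desc_genCocone (X : WHDTS Lab) :
    (isColimitCubicalPartCocone X).desc (genCocone X) = cubicalPartι X :=
  (isColimitCubicalPartCocone X).hom_ext fun f =>
    ((isColimitCubicalPartCocone X).fac _ f).trans
      (liftCubicalPart_ι (isCubeGenerated_genFunctor f.left) f.hom).symm

/-- This carries facts about the explicit model over to an arbitrary colimit cocone. -/
lemma desc_genCocone_eq {X : WHDTS Lab} {c : Cocone (genDiagram X)} (hc : IsColimit c) :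
    hc.desc (genCocone X) =
      (hc.coconePointUniqueUpToIso (isColimitCubicalPartCocone X)).hom ≫ cubicalPartι X :=
  hc.hom_ext fun f => by
    rw [hc.fac]
    exact (liftCubicalPart_ι (isCubeGenerated_genFunctor f.left) f.hom).symm.trans
      (hc.comp_coconePointUniqueUpToIso_hom_assoc (isColimitCubicalPartCocone X) f
        (cubicalPartι X)).symm

/-- A cubical transition system is the colimit of its cubes and double transitions. -/
noncomputable def IsCubeGenerated.isColimitGenCocone {X : WHDTS Lab} (hX : IsCubeGenerated X) :
    IsColimit (genCocone X) := by
  have : IsIso ((isColimitCubicalPartCocone X).desc (genCocone X)) := by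
    rw [desc_genCocone]
    exact hX.isIso
  exact IsColimit.ofPointIso (isColimitCubicalPartCocone X)

/-! ### The coreflection -/

lemma bijective_of_iso {X Y : WHDTS Lab} (e : X ≅ Y) :
    Function.Bijective (mapState e.hom) ∧ Function.Bijective (mapAction e.hom) := by
  refine ⟨Function.bijective_iff_has_inverse.2 ⟨mapState e.inv, ?_, ?_⟩,
    Function.bijective_iff_has_inverse.2 ⟨mapAction e.inv, ?_, ?_⟩⟩
  · exact congrFun (congrArg mapState e.hom_inv_id)
  · exact congrFun (congrArg mapState e.inv_hom_id)
  · exact congrFun (congrArg mapAction e.hom_inv_id)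
  · exact congrFun (congrArg mapAction e.inv_hom_id)

instance : (IsCubical Lab).IsClosedUnderIsomorphisms where
  of_iso e h := (isCubical_iff _).2 (((isCubical_iff _).1 h).of_iso e)

lemma counit_properties {X : WHDTS Lab} {c : Cocone (genDiagram X)} (hc : IsColimit c)
    (q : c.pt ⟶ X) (hq : q = hc.desc (genCocone X)) :
    Function.Bijective (mapState q) ∧
    Function.Injective (mapAction q) ∧
    Function.Injective (mapTransition q) ∧
    (IsCubical Lab X ↔ IsIso q) ∧
    IsCubical Lab c.pt ∧
    ∀ Y : WHDTS Lab, IsCubical Lab Y → ∀ g : Y ⟶ X, ∃! h : Y ⟶ c.pt, h ≫ q = g := by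
  rw [desc_genCocone_eq] at hq
  set e := hc.coconePointUniqueUpToIso (isColimitCubicalPartCocone X)
  obtain ⟨he1, he2⟩ := bijective_of_iso e
  have hs : Function.Bijective (mapState q) := by
    rw [hq]
    exact (mapState_cubicalPartι_bijective X).comp he1
  have ha : Function.Injective (mapAction q) := by
    rw [hq]
    exact (mapAction_cubicalPartι_injective X).comp he2.1
  have hpt : IsCubical Lab c.pt :=
    (isCubical_iff _).2 ((isCubeGenerated_cubicalPart X).of_iso e.symm)
  refine ⟨hs, ha, mapTransition_injective q hs.1 ha, ⟨fun h => ?_, fun h => ?_⟩, hpt,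
    fun Y hY g => ?_⟩
  · have := ((isCubical_iff X).1 h).isIso
    rw [hq]
    exact IsIso.comp_isIso' (inferInstanceAs (IsIso e.hom)) this
  · exact (IsCubical Lab).prop_of_iso (asIso q) hpt
  · have := mono_of_injective q hs.1 ha
    refine ⟨liftCubicalPart ((isCubical_iff Y).1 hY) g ≫ e.inv, ?_, fun h hh => ?_⟩
    · rw [hq]
      exact (Category.assoc _ _ _).trans ((congrArg _ (e.inv_hom_id_assoc _)).trans
        (liftCubicalPart_ι _ _))
    · rw [← cancel_mono q, hh, hq]
      exact ((Category.assoc _ _ _).trans ((congrArg _ (e.inv_hom_id_assoc _)).trans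
        (liftCubicalPart_ι _ _))).symm

/-- The cubical part, as a cubical transition system. -/
def toCTS (X : WHDTS Lab) : CTS Lab :=
  ⟨cubicalPart X, (isCubical_iff _).2 (isCubeGenerated_cubicalPart X)⟩

/-- The universal property of the cubical part. -/
noncomputable def homEquivToCTS (Y : CTS Lab) (X : WHDTS Lab) :
    (Y.obj ⟶ X) ≃ (Y ⟶ toCTS X) where
  toFun g := ObjectProperty.homMk (liftCubicalPart ((isCubical_iff _).1 Y.property) g)
  invFun h := h.hom ≫ cubicalPartι X
  left_inv g := liftCubicalPart_ι ((isCubical_iff _).1 Y.property) g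
  right_inv h := by
    ext
    exact (cancel_mono (cubicalPartι X)).1
      (liftCubicalPart_ι ((isCubical_iff _).1 Y.property) (h.hom ≫ cubicalPartι X))

/-- Cubical transition systems are coreflective. -/
noncomputable instance coreflectiveIsCubical : Coreflective (IsCubical Lab).ι where
  R := _
  adj := Adjunction.adjunctionOfEquivRight (F := (IsCubical Lab).ι) homEquivToCTS
    (fun _ Y X f g => (Equiv.eq_symm_apply _).1
      ((congrArg (f.hom ≫ ·) (liftCubicalPart_ι ((isCubical_iff _).1 Y.property) g).symm).trans
        (Category.assoc f.hom (liftCubicalPart ((isCubical_iff _).1 Y.property) g)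
          (cubicalPartι X)).symm))

/-! ### Colimits of weak HDTS -/

/-- The functor sending a weak HDTS to its set of states. -/
def stateFunctor (Lab : Type u) : WHDTS Lab ⥤ Type u where
  obj X := X.State
  map f := TypeCat.ofHom (mapState f)

/-- The functor sending a weak HDTS to its set of actions. -/
def actionFunctor (Lab : Type u) : WHDTS Lab ⥤ Type u where
  obj X := X.Action
  map f := TypeCat.ofHom (mapAction f)

section colimit

variable {J : Type u} [Category.{u} J] {F : J ⥤ WHDTS Lab}

lemma mapState_w (c : Cocone F) {i j : J} (u : i ⟶ j) (a : (F.obj i).State) :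
    mapState (c.ι.app j) (mapState (F.map u) a) = mapState (c.ι.app i) a :=
  congrFun (congrArg mapState (c.w u)) a

lemma mapAction_w (c : Cocone F) {i j : J} (u : i ⟶ j) (a : (F.obj i).Action) :
    mapAction (c.ι.app j) (mapAction (F.map u) a) = mapAction (c.ι.app i) a :=
  congrFun (congrArg mapAction (c.w u)) a

/-- The transitions of the point of a cocone that come from the diagram. -/
def StageTr (c : Cocone F) (a : c.pt.State) (l : List c.pt.Action) (b : c.pt.State) : Prop :=
  ∃ j, ImageTr (c.ι.app j) a l b

variable (F)

/-- The labelling map of a colimit. -/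
noncomputable def colimitLabel : (colimit (F ⋙ actionFunctor Lab) : Type u) → Lab :=
  ConcreteCategory.hom (colimit.desc (F ⋙ actionFunctor Lab)
    { pt := Lab
      ι :=
        { app := fun j => TypeCat.ofHom (F.obj j).label
          naturality := fun _ _ u => by
            ext v
            exact label_mapAction (F.map u) v } })

lemma colimitLabel_ι (j : J) (v : (F.obj j).Action) :
    colimitLabel F (colimit.ι (F ⋙ actionFunctor Lab) j v) = (F.obj j).label v :=
  ConcreteCategory.congr_hom (colimit.ι_desc (F := F ⋙ actionFunctor Lab)
    { pt := Lab
      ι :=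
        { app := fun j => TypeCat.ofHom (F.obj j).label
          naturality := fun _ _ u => by
            ext v
            exact label_mapAction (F.map u) v } } j) v

/-- The colimit of a diagram of weak HDTS. -/
noncomputable def colimitObj : WHDTS Lab :=
  generate (S := colimit (F ⋙ stateFunctor Lab)) (A := colimit (F ⋙ actionFunctor Lab))
    (colimitLabel F)
    (fun a l b => ∃ (j : J) (a' : (F.obj j).State) (l' : List (F.obj j).Action)
      (b' : (F.obj j).State), (F.obj j).Tr a' l' b' ∧
        colimit.ι (F ⋙ stateFunctor Lab) j a' = a ∧
        l'.map (colimit.ι (F ⋙ actionFunctor Lab) j) = l ∧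
        colimit.ι (F ⋙ stateFunctor Lab) j b' = b)
    (by
      rintro _ _ _ ⟨j, a, l, b, h, rfl, rfl, rfl⟩ hl
      exact (F.obj j).ne_nil h (List.map_eq_nil_iff.1 hl))

/-- The colimit cocone of a diagram of weak HDTS. -/
noncomputable def colimitCocone : Cocone F where
  pt := colimitObj F
  ι :=
    { app j := mkHom (colimit.ι (F ⋙ stateFunctor Lab) j) (colimit.ι (F ⋙ actionFunctor Lab) j)
        (colimitLabel_ι F j) (fun h => .base ⟨j, _, _, _, h, rfl, rfl, rfl⟩)
      naturality i j u := by
        refine hom_ext (funext fun a => ?_) (funext fun a => ?_)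
        · exact ConcreteCategory.congr_hom (colimit.w (F ⋙ stateFunctor Lab) u) a
        · exact ConcreteCategory.congr_hom (colimit.w (F ⋙ actionFunctor Lab) u) a }

lemma colimitObj_hom_ext {Z : WHDTS Lab} {f g : colimitObj F ⟶ Z}
    (h : ∀ j, (colimitCocone F).ι.app j ≫ f = (colimitCocone F).ι.app j ≫ g) : f = g := by
  refine hom_ext (funext fun a => ?_) (funext fun a => ?_)
  · obtain ⟨j, a, rfl⟩ := Types.jointly_surjective_of_isColimit
      (colimit.isColimit (F ⋙ stateFunctor Lab)) a
    exact congrFun (congrArg mapState (h j)) a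
  · obtain ⟨j, a, rfl⟩ := Types.jointly_surjective_of_isColimit
      (colimit.isColimit (F ⋙ actionFunctor Lab)) a
    exact congrFun (congrArg mapAction (h j)) a

/-- States and actions descend by the universal property in sets; `Closure.toTr` leaves only
transitions coming from a stage to check. -/
lemma exists_colimitDesc (s : Cocone F) :
    ∃ d : colimitObj F ⟶ s.pt, ∀ j, (colimitCocone F).ι.app j ≫ d = s.ι.app j := by
  let st : (colimit (F ⋙ stateFunctor Lab) : Type u) → s.pt.State :=
    ConcreteCategory.hom (colimit.desc (F ⋙ stateFunctor Lab) ((stateFunctor Lab).mapCocone s))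
  let ac : (colimit (F ⋙ actionFunctor Lab) : Type u) → s.pt.Action :=
    ConcreteCategory.hom (colimit.desc (F ⋙ actionFunctor Lab) ((actionFunctor Lab).mapCocone s))
  have hst (j : J) (a : (F.obj j).State) :
      st (colimit.ι (F ⋙ stateFunctor Lab) j a) = mapState (s.ι.app j) a :=
    ConcreteCategory.congr_hom (colimit.ι_desc (F := F ⋙ stateFunctor Lab)
      ((stateFunctor Lab).mapCocone s) j) a
  have hac (j : J) (a : (F.obj j).Action) :
      ac (colimit.ι (F ⋙ actionFunctor Lab) j a) = mapAction (s.ι.app j) a :=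
    ConcreteCategory.congr_hom (colimit.ι_desc (F := F ⋙ actionFunctor Lab)
      ((actionFunctor Lab).mapCocone s) j) a
  refine ⟨mkHom st ac (fun v => ?_) (fun h => Closure.toTr ?_ h), fun j =>
    hom_ext (funext (hst j)) (funext (hac j))⟩
  · obtain ⟨j, v, rfl⟩ := Types.jointly_surjective_of_isColimit
      (colimit.isColimit (F ⋙ actionFunctor Lab)) v
    exact ((congrArg s.pt.label (hac j v)).trans (label_mapAction _ _)).trans
      (colimitLabel_ι F j v).symm
  · rintro _ _ _ ⟨j, a, l, b, h, rfl, rfl, rfl⟩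
    have := tr_map (s.ι.app j) h
    have e : (l.map (colimit.ι (F ⋙ actionFunctor Lab) j)).map ac =
        l.map (mapAction (s.ι.app j)) := by
      refine List.map_map.trans ?_
      exact List.map_congr_left fun v _ => hac j v
    rw [← e, ← hst, ← hst] at this
    exact this

/-- The colimit cocone is a colimit. -/
noncomputable def isColimitColimitCocone : IsColimit (colimitCocone F) where
  desc s := (exists_colimitDesc F s).choose
  fac s := (exists_colimitDesc F s).choose_spec
  uniq s _ hm := colimitObj_hom_ext F fun j =>
    (hm j).trans ((exists_colimitDesc F s).choose_spec j).symm

instance : HasColimitsOfSize.{u, u} (WHDTS Lab) where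
  has_colimits_of_shape _ _ := ⟨fun F => ⟨_, isColimitColimitCocone F⟩⟩

instance : PreservesColimit F (stateFunctor Lab) :=
  preservesColimit_of_preserves_colimit_cocone (isColimitColimitCocone F)
    ((colimit.isColimit (F ⋙ stateFunctor Lab)).ofIsoColimit
      (Cocone.ext (Iso.refl _) fun _ => rfl))

instance : PreservesColimit F (actionFunctor Lab) :=
  preservesColimit_of_preserves_colimit_cocone (isColimitColimitCocone F)
    ((colimit.isColimit (F ⋙ actionFunctor Lab)).ofIsoColimit
      (Cocone.ext (Iso.refl _) fun _ => rfl))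

end colimit

/-! ### Properties that hold from some stage on -/

section EventuallyFrom

variable {J : Type u} [Category.{u} J]

/-- A property of the arrows from `i` holds for all arrows that factor through a certain one. -/
def EventuallyFrom (i : J) (P : ∀ k, (i ⟶ k) → Prop) : Prop :=
  ∃ (k : J) (u : i ⟶ k), ∀ (m : J) (v : k ⟶ m), P m (u ≫ v)

variable {i : J} {P Q : ∀ k, (i ⟶ k) → Prop}

lemma EventuallyFrom.exists (h : EventuallyFrom i P) : ∃ k u, P k u := by
  obtain ⟨k, u, h⟩ := h
  exact ⟨k, _, h k (𝟙 k)⟩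

lemma EventuallyFrom.mono (h : EventuallyFrom i P) (hPQ : ∀ k u, P k u → Q k u) :
    EventuallyFrom i Q := by
  obtain ⟨k, u, h⟩ := h
  exact ⟨k, u, fun m v => hPQ _ _ (h m v)⟩

lemma EventuallyFrom.precomp {j : J} (u : i ⟶ j) (h : EventuallyFrom j fun k v => P k (u ≫ v)) :
    EventuallyFrom i P := by
  obtain ⟨k, v, h⟩ := h
  exact ⟨k, u ≫ v, fun m w => by simpa using h m w⟩

/-- In a filtered category, two arrows out of `i` extend to the same arrow, from which both
properties hold. -/
lemma EventuallyFrom.and [IsFiltered J] (hP : EventuallyFrom i P) (hQ : EventuallyFrom i Q) :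
    EventuallyFrom i fun k u => P k u ∧ Q k u := by
  obtain ⟨k, u, hP⟩ := hP
  obtain ⟨k', u', hQ⟩ := hQ
  obtain ⟨m, v, v', e⟩ := IsFiltered.span u u'
  refine ⟨m, u ≫ v, fun n w => ⟨?_, ?_⟩⟩
  · simpa using hP n (v ≫ w)
  · rw [e]
    simpa using hQ n (v' ≫ w)

lemma EventuallyFrom.forall [IsFiltered J] {T : Type*} [Finite T] {R : T → ∀ k, (i ⟶ k) → Prop}
    (h : ∀ t, EventuallyFrom i (R t)) : EventuallyFrom i fun k u => ∀ t, R t k u := by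
  classical
  have := Fintype.ofFinite T
  have key (s : Finset T) : EventuallyFrom i fun k u => ∀ t ∈ s, R t k u := by
    induction s using Finset.induction_on with
    | empty => exact ⟨i, 𝟙 i, by simp⟩
    | insert t s _ ih => exact ((h t).and ih).mono fun k u h => by simpa using h
  exact (key Finset.univ).mono fun k u h t => h t (Finset.mem_univ t)

end EventuallyFrom

/-! ### Transitions of filtered colimits -/

section filtered

variable {J : Type u} [Category.{u} J] {F : J ⥤ WHDTS Lab} {c : Cocone F}
  (hc : IsColimit c)

include hc

lemma exists_state (a : c.pt.State) : ∃ j a', mapState (c.ι.app j) a' = a :=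
  Types.jointly_surjective_of_isColimit (isColimitOfPreserves (stateFunctor Lab) hc) a

lemma exists_action (a : c.pt.Action) : ∃ j a', mapAction (c.ι.app j) a' = a :=
  Types.jointly_surjective_of_isColimit (isColimitOfPreserves (actionFunctor Lab) hc) a

variable [IsFiltered J]

lemma eventually_state_eq {i : J} {a b : (F.obj i).State}
    (h : mapState (c.ι.app i) a = mapState (c.ι.app i) b) :
    EventuallyFrom i fun _ u => mapState (F.map u) a = mapState (F.map u) b := by
  obtain ⟨k, u, h⟩ := (Types.FilteredColimit.isColimit_eq_iff'
    (isColimitOfPreserves (stateFunctor Lab) hc) a b).1 h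
  refine ⟨k, u, fun m v => ?_⟩
  simp only [F.map_comp, mapState_comp]
  exact congrArg (mapState (F.map v)) h

lemma eventually_action_eq {i : J} {a b : (F.obj i).Action}
    (h : mapAction (c.ι.app i) a = mapAction (c.ι.app i) b) :
    EventuallyFrom i fun _ u => mapAction (F.map u) a = mapAction (F.map u) b := by
  obtain ⟨k, u, h⟩ := (Types.FilteredColimit.isColimit_eq_iff'
    (isColimitOfPreserves (actionFunctor Lab) hc) a b).1 h
  refine ⟨k, u, fun m v => ?_⟩
  simp only [F.map_comp, mapAction_comp]
  exact congrArg (mapAction (F.map v)) h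

lemma eventually_list_eq {i : J} : ∀ {l l' : List (F.obj i).Action},
    l.map (mapAction (c.ι.app i)) = l'.map (mapAction (c.ι.app i)) →
    EventuallyFrom i fun _ u => l.map (mapAction (F.map u)) = l'.map (mapAction (F.map u))
  | [], [], _ => ⟨i, 𝟙 i, fun _ _ => rfl⟩
  | v :: l, v' :: l', h => by
    simp only [List.map_cons, List.cons.injEq] at h ⊢
    exact (eventually_action_eq hc h.1).and (eventually_list_eq h.2)

/-- Every lift of a transition coming from some stage of a filtered diagram becomes a transition
at some later stage. -/
lemma eventually_tr {i : J} {a : (F.obj i).State} {l : List (F.obj i).Action}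
    {b : (F.obj i).State} (h : StageTr c (mapState (c.ι.app i) a)
      (l.map (mapAction (c.ι.app i))) (mapState (c.ι.app i) b)) :
    EventuallyFrom i fun k u =>
      (F.obj k).Tr (mapState (F.map u) a) (l.map (mapAction (F.map u))) (mapState (F.map u) b) := by
  obtain ⟨j, a', l', b', h, ha, hl, hb⟩ := h
  let k := IsFiltered.max i j
  let u : i ⟶ k := IsFiltered.leftToMax i j
  let v : j ⟶ k := IsFiltered.rightToMax i j
  refine .precomp u ?_
  -- The lift coming from stage `j` and the given one agree in the colimit, hence at a later stage.
  have ha' := eventually_state_eq hc (a := mapState (F.map v) a') (b := mapState (F.map u) a)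
    (by rw [mapState_w, mapState_w, ha])
  have hb' := eventually_state_eq hc (a := mapState (F.map v) b') (b := mapState (F.map u) b)
    (by rw [mapState_w, mapState_w, hb])
  have hl' := eventually_list_eq hc (l := l'.map (mapAction (F.map v)))
    (l' := l.map (mapAction (F.map u)))
    (by simpa [Function.comp_def, mapAction_w] using hl)
  refine ((ha'.and hb').and hl').mono ?_
  rintro m w ⟨⟨h1, h2⟩, h3⟩
  have := tr_map (F.map w) (tr_map (F.map v) h)
  rw [h1, h2, h3] at this
  simpa using this

omit hc [IsFiltered J] in
lemma stageTr_multiset {a : c.pt.State} {l l' : List c.pt.Action} {b : c.pt.State}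
    (hl : l.Perm l') (h : StageTr c a l b) : StageTr c a l' b := by
  obtain ⟨j, a, m, b, h, rfl, rfl, rfl⟩ := h
  obtain ⟨m', hm, hm'⟩ := List.perm_comp_forall₂ (r := fun x y => x = mapAction (c.ι.app j) y)
    hl.symm (List.forall₂_map_left_iff.2 (List.forall₂_same.2 fun _ _ => rfl))
  rw [← List.forall₂_map_right_iff, List.forall₂_eq_eq_eq] at hm
  exact ⟨j, a, m', b, (F.obj j).multiset hm'.symm h, rfl, hm.symm, rfl⟩

/-- All five hypotheses hold simultaneously at a late enough stage, where the coherence axiom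
applies. -/
lemma stageTr_coherence {a n₁ n₂ b : c.pt.State} {l₁ l₂ l₃ : List c.pt.Action} (hl : l₂ ≠ [])
    (h₁ : StageTr c a (l₁ ++ l₂ ++ l₃) b) (h₂ : StageTr c a l₁ n₁)
    (h₃ : StageTr c n₁ (l₂ ++ l₃) b) (h₄ : StageTr c a (l₁ ++ l₂) n₂) (h₅ : StageTr c n₂ l₃ b) :
    StageTr c n₁ l₂ n₂ := by
  -- The longest transition supplies common lifts of the endpoints and of all three lists; only the
  -- intermediate states must be lifted separately.
  obtain ⟨i, a', l', b', h, rfl, hl', rfl⟩ := id h₁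
  obtain ⟨l₁₂', l₃', rfl, hl₁₂, rfl⟩ := List.map_eq_append_iff.1 hl'
  obtain ⟨l₁', l₂', rfl, rfl, rfl⟩ := List.map_eq_append_iff.1 hl₁₂
  obtain ⟨j, n₁, rfl⟩ := exists_state hc n₁
  obtain ⟨k, n₂, rfl⟩ := exists_state hc n₂
  obtain ⟨m, u, v, w, -⟩ : ∃ (m : J) (_ : i ⟶ m) (_ : j ⟶ m) (_ : k ⟶ m), True :=
    ⟨_, IsFiltered.firstToMax₃ i j k, IsFiltered.secondToMax₃ i j k,
      IsFiltered.thirdToMax₃ i j k, trivial⟩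
  have ha (x) : mapState (c.ι.app i) x = mapState (c.ι.app m) (mapState (F.map u) x) :=
    (mapState_w c u x).symm
  have he (l : List (F.obj i).Action) : l.map (mapAction (c.ι.app i)) =
      (l.map (mapAction (F.map u))).map (mapAction (c.ι.app m)) := by
    simp [Function.comp_def, mapAction_w]
  rw [← mapState_w c v, ← mapState_w c w]
  rw [← mapState_w c v] at h₂ h₃
  rw [← mapState_w c w] at h₄ h₅
  simp only [ha, he, ← List.map_append] at h₁ h₂ h₃ h₄ h₅ ⊢
  obtain ⟨o, z, ⟨⟨⟨⟨h₁, h₂⟩, h₃⟩, h₄⟩, h₅⟩⟩ := ((((eventually_tr hc h₁).and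
    (eventually_tr hc h₂)).and (eventually_tr hc h₃)).and (eventually_tr hc h₄)).and
    (eventually_tr hc h₅) |>.exists
  simp only [List.map_append] at h₁ h₃ h₄
  refine ⟨o, _, _, _, (F.obj o).coherence (by simpa using hl) h₁ h₂ h₃ h₄ h₅, mapState_w _ _ _,
    ?_, mapState_w _ _ _⟩
  simp [Function.comp_def, mapAction_w]

/-- The transitions of a filtered colimit come from the diagram. -/
lemma stageTr_of_tr {a : c.pt.State} {l : List c.pt.Action} {b : c.pt.State}
    (h : c.pt.Tr a l b) : StageTr c a l b := by
  -- Keep the states and actions of the colimit but only the transitions coming from stages. The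
  -- diagram maps to `Z`, and the induced map from the colimit is a section of the
  -- identity-on-elements map `p`, so it is the identity on elements too.
  let Z : WHDTS Lab :=
    { State := c.pt.State
      Action := c.pt.Action
      label := c.pt.label
      Tr := StageTr c
      ne_nil := by
        rintro _ _ _ ⟨j, h⟩
        exact c.pt.ne_nil h.tr
      multiset := stageTr_multiset
      coherence := stageTr_coherence hc }
  let st (j : J) : (F.obj j).State → c.pt.State := mapState (c.ι.app j)
  let ac (j : J) : (F.obj j).Action → c.pt.Action := mapAction (c.ι.app j)
  let s : Cocone F :=
    { pt := Z
      ι :=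
        { app j := mkHom (st j) (ac j) (label_mapAction (c.ι.app j))
            (fun h => ⟨j, _, _, _, h, rfl, rfl, rfl⟩)
          naturality i j u := hom_ext (funext (mapState_w c u)) (funext (mapAction_w c u)) } }
  let p : Z ⟶ c.pt := mkHom id id (fun _ => rfl) (by
    rintro _ _ _ ⟨j, h⟩
    rw [List.map_id]
    exact h.tr)
  have e : hc.desc s ≫ p = 𝟙 c.pt := hc.hom_ext fun j => by
    rw [hc.fac_assoc, Category.comp_id]
    rfl
  have h := tr_map (hc.desc s) h
  have e1 : mapState (hc.desc s) = id := congrArg mapState e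
  have e2 : mapAction (hc.desc s) = id := congrArg mapAction e
  rw [e1, e2, List.map_id] at h
  exact h

end filtered

/-! ### Finite presentability -/

section finite

variable {X : WHDTS Lab} {J : Type u} [Category.{u} J] [IsFiltered J] {F : J ⥤ WHDTS Lab}
  {c : Cocone F} (hc : IsColimit c)

include hc

/-- Finitely many states and actions lift to one stage, and each of the finitely many transitions
holds from some later stage on. Labels need no adjustment, since cocone maps preserve them. -/
lemma exists_factor_of_finite [Finite X.State] [Finite X.Action] [Finite X.Transition]
    (f : X ⟶ c.pt) : ∃ (j : J) (g : X ⟶ F.obj j), g ≫ c.ι.app j = f := by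
  choose js s hs using fun a => exists_state hc (mapState f a)
  choose ja t ht using fun v => exists_action hc (mapAction f v)
  obtain ⟨k, hk⟩ : ∃ k : J, ∀ x : X.State ⊕ X.Action, Nonempty (Sum.elim js ja x ⟶ k) := by
    classical
    have := Fintype.ofFinite (X.State ⊕ X.Action)
    obtain ⟨k, hk⟩ := IsFiltered.sup_objs_exists (Finset.univ.image (Sum.elim js ja))
    exact ⟨k, fun x => hk (Finset.mem_image_of_mem _ (Finset.mem_univ x))⟩
  let us (a : X.State) : js a ⟶ k := (hk (.inl a)).some
  let ua (v : X.Action) : ja v ⟶ k := (hk (.inr v)).some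
  let s' (a : X.State) : (F.obj k).State := mapState (F.map (us a)) (s a)
  let t' (v : X.Action) : (F.obj k).Action := mapAction (F.map (ua v)) (t v)
  have hs' (a) : mapState (c.ι.app k) (s' a) = mapState f a := (mapState_w c (us a) (s a)).trans (hs a)
  have ht' (v) : mapAction (c.ι.app k) (t' v) = mapAction f v := (mapAction_w c (ua v) (t v)).trans (ht v)
  obtain ⟨m, u, h⟩ := (EventuallyFrom.forall fun x : X.Transition => eventually_tr hc
    (a := s' x.1.1) (l := x.1.2.1.map t') (b := s' x.1.2.2) (by
      have := stageTr_of_tr hc (tr_map f x.2)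
      have e : (x.1.2.1.map t').map (mapAction (c.ι.app k)) = x.1.2.1.map (mapAction f) := by
        rw [List.map_map]
        exact List.map_congr_left fun v _ => ht' v
      rwa [hs', hs', e])).exists
  refine ⟨m, mkHom (fun a => mapState (F.map u) (s' a)) (fun v => mapAction (F.map u) (t' v))
    (fun v => ?_) (fun {a l b} hx => ?_), hom_ext (funext fun a => ?_) (funext fun v => ?_)⟩
  · rw [label_mapAction, ← label_mapAction (c.ι.app k)]
    exact (congrArg c.pt.label (ht' v)).trans (label_mapAction f v)
  · have := h ⟨(a, l, b), hx⟩
    rwa [List.map_map] at this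
  · exact (mapState_w c u (s' a)).trans (hs' a)
  · exact (mapAction_w c u (t' v)).trans (ht' v)

lemma eventually_hom_eq_of_finite [Finite X.State] [Finite X.Action] {i : J} (f g : X ⟶ F.obj i)
    (h : f ≫ c.ι.app i = g ≫ c.ι.app i) : ∃ (k : J) (u : i ⟶ k), f ≫ F.map u = g ≫ F.map u := by
  have h1 := EventuallyFrom.forall fun a : X.State =>
    eventually_state_eq hc (congrFun (congrArg mapState h) a)
  have h2 := EventuallyFrom.forall fun v : X.Action =>
    eventually_action_eq hc (congrFun (congrArg mapAction h) v)
  obtain ⟨k, u, h1, h2⟩ := (h1.and h2).exists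
  exact ⟨k, u, hom_ext (funext h1) (funext h2)⟩

end finite

attribute [local instance] Cardinal.fact_isRegular_aleph0

lemma isFinitelyPresentable_of_finite (X : WHDTS Lab) [Finite X.State] [Finite X.Action]
    [Finite X.Transition] : IsFinitelyPresentable.{u} X := by
  refine ⟨fun J _ _ => ⟨fun {F} => ⟨fun {c} hc => ?_⟩⟩⟩
  have := isFiltered_of_isCardinalFiltered J Cardinal.aleph0.{u}
  refine ⟨Types.FilteredColimit.isColimitOf' _ _ (fun f => ?_) (fun i f g h => ?_)⟩
  · obtain ⟨j, g, hg⟩ := exists_factor_of_finite hc f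
    exact ⟨j, g, hg.symm⟩
  · exact eventually_hom_eq_of_finite hc f g h

/-- The inclusion is a left adjoint, so it preserves colimits, and it is fully faithful: the functor
represented by `X` is the inclusion followed by the one represented by `X.obj`. -/
lemma isFinitelyPresentable_cts (X : CTS Lab) [IsFinitelyPresentable.{u} X.obj] :
    IsFinitelyPresentable.{u} X := by
  have : PreservesColimitsOfSize.{u, u} (IsCubical Lab).ι :=
    (coreflectorAdjunction (IsCubical Lab).ι).leftAdjoint_preservesColimits
  exact Functor.isCardinalAccessible_of_natIso
    (F := (IsCubical Lab).ι ⋙ coyoneda.obj (Opposite.op X.obj))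
    (NatIso.ofComponents (fun Y : CTS Lab => Equiv.toIso
      { toFun := fun f : X.obj ⟶ Y.obj => (ObjectProperty.homMk f : X ⟶ Y)
        invFun := fun f : X ⟶ Y => f.hom
        left_inv := fun _ => rfl
        right_inv := fun _ => rfl })
      (fun f => by ext; rfl)) Cardinal.aleph0.{u}

lemma finite_genFunctor (s : Gen Lab) : Finite ((genFunctor Lab).obj s).State ∧
    Finite ((genFunctor Lab).obj s).Action ∧ Finite ((genFunctor Lab).obj s).Transition := by
  match s with
  | .cube n x =>
    refine ⟨inferInstanceAs (Finite (ULift (Fin n → Bool))),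
      inferInstanceAs (Finite (ULift (Fin n))), ?_⟩
    -- Actions in a transition of a cube are distinct, and a finite set has finitely many
    -- duplicate-free lists.
    refine Finite.of_injective (β := ULift.{u} (Fin n → Bool) ×
      {l : List (ULift.{u} (Fin n)) // l.Nodup} × ULift.{u} (Fin n → Bool))
      (fun t => (t.1.1, ⟨t.1.2.1, t.2.2.1⟩, t.1.2.2)) ?_
    rintro ⟨⟨a, l, b⟩, h⟩ ⟨⟨a', l', b'⟩, h'⟩ e
    obtain ⟨h1, h2⟩ := Prod.mk.inj e
    obtain ⟨h2, h3⟩ := Prod.mk.inj h2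
    obtain rfl := h1
    obtain rfl := congrArg Subtype.val h2
    obtain rfl := h3
    rfl
  | .double x =>
    refine ⟨inferInstanceAs (Finite (ULift (Fin 4))), inferInstanceAs (Finite PUnit), ?_⟩
    refine Finite.of_injective (β := ULift.{u} (Fin 4) × ULift.{u} (Fin 4))
      (fun t => (t.1.1, t.1.2.2)) ?_
    rintro ⟨⟨a, l, b⟩, h⟩ ⟨⟨a', l', b'⟩, h'⟩ e
    obtain rfl := h.1
    obtain rfl := h'.1
    obtain ⟨h1, h2⟩ := Prod.mk.inj e
    obtain rfl := h1
    obtain rfl := h2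
    rfl

lemma isCubical_genFunctor (s : Gen Lab) : IsCubical Lab ((genFunctor Lab).obj s) :=
  (isCubical_iff _).2 (isCubeGenerated_genFunctor s)

/-! ### Density and local presentability -/

/-- The inclusion of cubes and double transitions in cubical transition systems. -/
abbrev genFunctorCTS (Lab : Type u) : Gen Lab ⥤ CTS Lab :=
  (IsCubical Lab).lift (genFunctor Lab) isCubical_genFunctor

instance : (genFunctorCTS Lab).IsDense where
  isDenseAt Y := by
    have hY := ((isCubical_iff _).1 Y.property).isColimitGenCocone
    -- Cocones in the full subcategory are cocones in `WHDTS`, where `Y` is already the colimit.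
    let φ (s : Cocone (CostructuredArrow.proj (genFunctorCTS Lab) Y ⋙ genFunctorCTS Lab)) :
        Cocone (genDiagram Y.obj) :=
      { pt := s.pt.obj
        ι :=
          { app f := (s.ι.app (CostructuredArrow.mk (S := genFunctorCTS Lab) (Y := f.left)
              (ObjectProperty.homMk f.hom))).hom
            naturality f g h := congrArg InducedCategory.Hom.hom (s.ι.naturality
              (CostructuredArrow.homMk h.left
                (ObjectProperty.hom_ext _ (CostructuredArrow.w h)) :
                CostructuredArrow.mk (S := genFunctorCTS Lab) (Y := f.left)
                    (ObjectProperty.homMk f.hom) ⟶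
                  CostructuredArrow.mk (S := genFunctorCTS Lab) (Y := g.left)
                    (ObjectProperty.homMk g.hom))) } }
    exact ⟨{
      desc s := ObjectProperty.homMk (hY.desc (φ s))
      fac s j := ObjectProperty.hom_ext _ ((congrArg (· ≫ hY.desc (φ s))
        (Category.id_comp j.hom.hom)).trans (hY.fac (φ s)
          (CostructuredArrow.mk (S := genFunctor Lab) (Y := j.left) j.hom.hom)))
      uniq s m hm := ObjectProperty.hom_ext _ (hY.uniq (φ s) m.hom fun f =>
        (congrArg (· ≫ m.hom) (Category.id_comp f.hom).symm).trans
          (congrArg InducedCategory.Hom.hom (hm (CostructuredArrow.mk (S := genFunctorCTS Lab)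
            (Y := f.left) (ObjectProperty.homMk f.hom))))) }⟩

instance : HasColimitsOfSize.{u, u} (CTS Lab) :=
  ⟨fun _ _ => hasColimitsOfShape_of_coreflective (IsCubical Lab).ι⟩

lemma isLocallyFinitelyPresentable_cts : IsLocallyFinitelyPresentable.{u} (CTS Lab) := by
  refine (IsCardinalLocallyPresentable.iff_exists_isStrongGenerator _ _).2
    ⟨.ofObj (genFunctorCTS Lab).obj, inferInstance,
      Functor.isStrongGenerator_of_isDense (genFunctorCTS Lab), ?_⟩
  rintro _ ⟨s⟩
  obtain ⟨_, _, _⟩ := finite_genFunctor s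
  have : IsFinitelyPresentable.{u} ((genFunctorCTS Lab).obj s).obj :=
    isFinitelyPresentable_of_finite ((genFunctor Lab).obj s)
  exact isFinitelyPresentable_cts ((genFunctorCTS Lab).obj s)

end WHDTS

theorem mainTheorem10 (Lab : Type u) [Nonempty Lab] :
    -- the canonical map `q_X` from the colimit (which exists) to `X`
    (∀ X : WHDTS Lab, HasColimit (WHDTS.genDiagram X) ∧
      ∀ (c : Cocone (WHDTS.genDiagram X)) (hc : IsColimit c) (q : c.pt ⟶ X),
        q = hc.desc (WHDTS.genCocone X) →
        Function.Bijective (WHDTS.mapState q) ∧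
        Function.Injective (WHDTS.mapAction q) ∧
        Function.Injective (WHDTS.mapTransition q) ∧
        (WHDTS.IsCubical Lab X ↔ IsIso q) ∧
        -- `q_X` is the counit of the coreflection
        WHDTS.IsCubical Lab c.pt ∧
        ∀ Y : WHDTS Lab, WHDTS.IsCubical Lab Y → ∀ g : Y ⟶ X, ∃! h : Y ⟶ c.pt, h ≫ q = g) ∧
    -- cubical transition systems are a coreflective subcategory of weak HDTS
    (WHDTS.IsCubical Lab).IsClosedUnderIsomorphisms ∧
    Nonempty (Coreflective (WHDTS.IsCubical Lab).ι) ∧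
    -- they form a locally finitely presentable category
    IsLocallyFinitelyPresentable.{u} (WHDTS.CTS Lab) ∧
    -- the cubes and the double transitions are cubical, and they are dense among cubical ones
    ∃ h : ∀ s : WHDTS.Gen Lab, WHDTS.IsCubical Lab ((WHDTS.genFunctor Lab).obj s),
      ((WHDTS.IsCubical Lab).lift (WHDTS.genFunctor Lab) h).IsDense := by
  refine ⟨fun X => ⟨⟨_, WHDTS.isColimitCubicalPartCocone X⟩,
    fun c hc q hq => WHDTS.counit_properties hc q hq⟩, inferInstance, ⟨inferInstance⟩,
    WHDTS.isLocallyFinitelyPresentable_cts, WHDTS.isCubical_genFunctor, inferInstance⟩
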